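/- Let $d\ge 2$, $D_S,D_A>0$ and $\mathfrak e\ge 0$. Let $\Omega=\Omega_f\times S^{d-1}\subset\mathbb M=\mathbb R^d\rtimes S^{d-1}$ with $\Omega_f\subset\mathbb R^d$ open and of finite volume. Let $\mu$ be the measure of the volume form $d\mu=D_S^{-1}dx\wedge D_A^{-1}d\sigma_{S^{d-1}}$, let $|\Omega|=\mu(\Omega)$, and let $L^2(\Omega)$ be taken with respect to $\mu$, with norm $\|\cdot\|$. For a tangent vector $\dot p=(\dot x,\dot n)$ at $p=(x,n)\in\mathbb M$ put $$\|\dot p\|_{\mathfrak e}^2=D_S^{-1}|\dot x\cdot n|^2+D_A^{-1}\|\dot n\|^2+\mathfrak e^{-2}D_S^{-1}\|\dot x\wedge n\|^2\quad(\mathfrak e>0),\qquad \|\dot p\|_0^2=D_S^{-1}|\dot x\cdot n|^2+D_A^{-1}\|\dot n\|^2;$$ for $\mathfrak e=0$ only horizontal vectors, i.e. those with $\dot x\wedge n=0$, are allowed. For a vector field $v$ on $\mathbb M$ let $\operatorname{div}v=\operatorname{div}_{\mathbb R^d}v+\operatorname{div}_{S^{d-1}}v$ if $\mathfrak e>0$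 and $\operatorname{div}v=n\cdot\nabla_{\mathbb R^d}(n\cdot v)+\operatorname{div}_{S^{d-1}}v$ if $\mathfrak e=0$. For $\varepsilon\ge 0$ define $TV_\varepsilon:L^2(\Omega)\to[0,\infty]$ by $$TV_\varepsilon(U)=\sup_{(\psi,v)}\int_\Omega\big(\varepsilon\,\psi+U\operatorname{div}v\big)\,d\mu,$$ where the supremum is over all $\psi\in C_c^\infty(\Omega)$ and all smooth compactly supported vector fields $v$ on $\mathbb M$ (horizontal if $\mathfrak e=0$) that vanish on $\partial\Omega$, such that $\|v(p)\|_{\mathfrak e}^2+|\psi(p)|^2\le 1$ for all $p\in\Omega$. (If $\Omega_f$ is bounded, the compactness of the support of $v$ is no restriction.) For a functional $F:H\to[0,\infty]$ on a Hilbert space $H$ and $u$ with $F(u)<\infty$ let $\partial F(u)=\{z\in H:(z,w-u)\le F(w)-F(u)\text{ for all }w\in H\}$, and let $\operatorname{grad}F(u)$ be its element of minimal norm. The gradient flow of $F$ starting at $u_0$ is the curve $u:[0,\infty)\to H$ that is locally absolutely continuous on $(0,\infty)$, satisfies $-u'(t)=\operatorname{grad}F(u(t))$ for a.e. $t>0$,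 and has $u(0)=u_0=\lim_{t\downarrow0}u(t)$. **Theorem.** Let $U\in L^2(\Omega)$ and, for $\varepsilon\ge0$, let $W^\varepsilon$ be the gradient flow of $TV_\varepsilon$ on $L^2(\Omega)$ starting at $U$. Then for every $t\ge 0$ $$\lim_{\varepsilon\downarrow0}W^\varepsilon(\cdot,t)=W^0(\cdot,t)\quad\text{in }L^2(\Omega).$$ If moreover $U$ has bounded variation, in the sense that $TV_0(U)<\infty$, then for all $\varepsilon\ge 0$ and $t\ge0$ $$\|W^\varepsilon(\cdot,t)-W^0(\cdot,t)\|\le 8\Big(\|U\|\,(TV_0(U)+\delta)\,\delta\,t^2\Big)^{1/5},\qquad \delta=\varepsilon|\Omega|.$$ -/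

import Mathlib

open MeasureTheory Filter Set Metric
open scoped Topology ENNReal Manifold ContDiff

namespace RotoTranslation

/-! ### The space of positions and orientations, with `d = m + 1` -/

/-- Euclidean space `ℝ^d`, `d = m + 1`. -/
abbrev Pos (m : ℕ) : Type := EuclideanSpace ℝ (Fin (m + 1))

/-- The unit sphere `S^(d-1)` in `ℝ^d`, `d = m + 1`. -/
abbrev Ori (m : ℕ) : Type := sphere (0 : Pos m) 1

/-- The space `ℝ^d ⋊ S^(d-1)` of positions and orientations (as a manifold: the product). -/
abbrev PosOri (m : ℕ) : Type := Pos m × Ori m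

/-- The model with corners of the product manifold `ℝ^d × S^(d-1)`. -/
noncomputable abbrev posOriModel (m : ℕ) :
    ModelWithCorners ℝ (Pos m × EuclideanSpace ℝ (Fin m))
      (ModelProd (Pos m) (EuclideanSpace ℝ (Fin m))) :=
  𝓘(ℝ, Pos m).prod (𝓡 m)

/-- `Ω = Ω_f × S^(d-1)`. -/
def dom {m : ℕ} (Ωf : Set (Pos m)) : Set (PosOri m) := Ωf ×ˢ (univ : Set (Ori m))

/-- The measure of the volume form `dμ = D_S⁻¹ dx ∧ D_A⁻¹ dσ`, with `σ` the surface measure. -/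
noncomputable def vol (m : ℕ) (DS DA : ℝ) : Measure (PosOri m) :=
  (ENNReal.ofReal DS⁻¹ • (volume : Measure (Pos m))).prod
    (ENNReal.ofReal DA⁻¹ • (volume : Measure (Pos m)).toSphere)

/-- The measure `μ` restricted to `Ω`. -/
noncomputable def volOn {m : ℕ} (DS DA : ℝ) (Ωf : Set (Pos m)) : Measure (PosOri m) :=
  (vol m DS DA).restrict (dom Ωf)

/-- The real Hilbert space `L²(Ω)`, with respect to `μ`. -/
abbrev L2 {m : ℕ} (DS DA : ℝ) (Ωf : Set (Pos m)) : Type :=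
  Lp ℝ 2 (volOn DS DA Ωf)

/-- The volume `|Ω|` as a real number. -/
noncomputable def domVol {m : ℕ} (DS DA : ℝ) (Ωf : Set (Pos m)) : ℝ :=
  (vol m DS DA (dom Ωf)).toReal

/-! ### Metric, vector fields, divergence -/

/-- The component of `w` orthogonal to the unit vector `n`; its length is `‖w ∧ n‖`. -/
noncomputable def orthPart {m : ℕ} (n : Ori m) (w : Pos m) : Pos m :=
  w - inner ℝ w (n : Pos m) • (n : Pos m)

/-- The squared length `𝒢_𝔢|_(x,n)(w, w)` of the tangent vector `w = (ẋ, ṅ)` at `(x, n)`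
(it does not depend on `x`).  For `𝔢 = 0` it is `𝒢_0`, to be used on horizontal vectors only. -/
noncomputable def metricSq {m : ℕ} (DS DA 𝔢 : ℝ) (n : Ori m) (w : Pos m × Pos m) : ℝ :=
  if 𝔢 = 0 then
    DS⁻¹ * (inner ℝ w.1 (n : Pos m)) ^ 2 + DA⁻¹ * ‖w.2‖ ^ 2
  else
    DS⁻¹ * (inner ℝ w.1 (n : Pos m)) ^ 2 + DA⁻¹ * ‖w.2‖ ^ 2
      + (𝔢 ^ 2)⁻¹ * DS⁻¹ * ‖orthPart n w.1‖ ^ 2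

/-- A smooth vector field on `ℝ^d × S^(d-1)`, written as a map into the ambient `ℝ^d × ℝ^d` whose
second component is tangent to the sphere.  In the sub-Riemannian case `𝔢 = 0` it takes values in
the sub-tangent bundle `ẋ ∧ n = 0`. -/
structure IsSmoothField {m : ℕ} (𝔢 : ℝ) (v : PosOri m → Pos m × Pos m) : Prop where
  smooth : ContMDiff (posOriModel m) 𝓘(ℝ, Pos m × Pos m) ∞ v
  tangent : ∀ p : PosOri m, inner ℝ (v p).2 (p.2 : Pos m) = 0
  horizontal : 𝔢 = 0 → ∀ p : PosOri m, orthPart p.2 (v p).1 = 0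

/-- The test fields `χ₀(Ω)`: smooth fields that vanish on `∂Ω`.  They have compact support, so that
they may be tested against `L²` functions on unbounded `Ω` too; for bounded `Ω` this is no
restriction on the values on `Ω`. -/
structure IsTestField {m : ℕ} (𝔢 : ℝ) (Ωf : Set (Pos m)) (v : PosOri m → Pos m × Pos m) :
    Prop extends IsSmoothField 𝔢 v where
  vanish : ∀ p ∈ frontier (dom Ωf), v p = 0
  compactSupp : HasCompactSupport v

/-- The test functions `C_c^∞(Ω)`. -/
structure IsTestFun {m : ℕ} (Ωf : Set (Pos m)) (ψ : PosOri m → ℝ) : Prop where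
  smooth : ContMDiff (posOriModel m) 𝓘(ℝ, ℝ) ∞ ψ
  compactSupp : HasCompactSupport ψ
  subset : tsupport ψ ⊆ dom Ωf

/-- Extension of a map on the sphere to `ℝ^d ∖ {0}`, constant along rays. -/
noncomputable def radialExt {m : ℕ} (w : Ori m → Pos m) (y : Pos m) : Pos m :=
  if h : y = 0 then 0
  else w ⟨‖y‖⁻¹ • y, by
    simp [norm_smul, inv_mul_cancel₀ (norm_ne_zero_iff.mpr h)]⟩

/-- The divergence on the sphere of a tangential field `w`.  The derivative of the radially constant
extension vanishes in the normal direction, so its full trace at `n` is the trace of the covariant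
derivative over the tangent space at `n`. -/
noncomputable def divSphere {m : ℕ} (w : Ori m → Pos m) (n : Ori m) : ℝ :=
  LinearMap.trace ℝ (Pos m) (fderiv ℝ (radialExt w) (n : Pos m)).toLinearMap

/-- The (sub-)Riemannian divergence: `div_{ℝ^d} v + div_{S^(d-1)} v` if `𝔢 ≠ 0` and
`n · ∇_{ℝ^d}(n · v) + div_{S^(d-1)} v` if `𝔢 = 0`. -/
noncomputable def divergence {m : ℕ} (𝔢 : ℝ) (v : PosOri m → Pos m × Pos m) (p : PosOri m) : ℝ :=
  (if 𝔢 = 0 then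
    fderiv ℝ (fun x : Pos m => inner ℝ (p.2 : Pos m) (v (x, p.2)).1) p.1 (p.2 : Pos m)
  else
    LinearMap.trace ℝ (Pos m) (fderiv ℝ (fun x : Pos m => (v (x, p.2)).1) p.1).toLinearMap)
  + divSphere (fun n => (v (p.1, n)).2) p.2

/-! ### Total roto-translation variation -/

/-- The pairs `(ψ, v)` with `ψ ∈ C_c^∞(Ω)`, `v ∈ χ₀(Ω)` and `‖v‖² + ψ² ≤ 1` on `Ω`. -/
structure IsAdmissible {m : ℕ} (DS DA 𝔢 : ℝ) (Ωf : Set (Pos m))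
    (ψ : PosOri m → ℝ) (v : PosOri m → Pos m × Pos m) : Prop where
  testFun : IsTestFun Ωf ψ
  testField : IsTestField 𝔢 Ωf v
  bound : ∀ p ∈ dom Ωf, metricSq DS DA 𝔢 p.2 (v p) + ψ p ^ 2 ≤ 1

/-- The regularized total variation `TV_ε : L²(Ω) → [0, ∞]`, the supremum of
`∫_Ω (ε ψ + U div v) dμ` over the admissible pairs.  (As `(0, 0)` is admissible the supremum is
nonnegative, so truncating negative integrals to `0` changes nothing.) -/
noncomputable def TV {m : ℕ} (DS DA 𝔢 : ℝ) (Ωf : Set (Pos m)) (ε : ℝ) (U : L2 DS DA Ωf) : ℝ≥0∞ :=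
  ⨆ (ψ : PosOri m → ℝ) (v : PosOri m → Pos m × Pos m) (_ : IsAdmissible DS DA 𝔢 Ωf ψ v),
    ENNReal.ofReal (∫ p, (ε * ψ p + U p * divergence 𝔢 v p) ∂(volOn DS DA Ωf))

/-- `U ∈ L²(Ω)` has bounded variation, with respect to the (sub-)Riemannian structure. -/
def IsBV {m : ℕ} (DS DA 𝔢 : ℝ) (Ωf : Set (Pos m)) (U : L2 DS DA Ωf) : Prop :=
  TV DS DA 𝔢 Ωf 0 U ≠ ⊤

/-! ### Gradient flows of functionals on a Hilbert space -/

section GradientFlow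

variable {H : Type*} [NormedAddCommGroup H] [InnerProductSpace ℝ H]

/-- The subdifferential of `F : H → [0, ∞]` at `u` (empty outside the finiteness domain). -/
def subdiff (F : H → ℝ≥0∞) (u : H) : Set H :=
  {z | F u ≠ ⊤ ∧
    ∀ v : H, (F u : EReal) + ((inner ℝ z (v - u) : ℝ) : EReal) ≤ (F v : EReal)}

/-- `g` is the gradient of `F` at `u`: the element of minimal norm of the subdifferential. -/
def IsGrad (F : H → ℝ≥0∞) (u g : H) : Prop :=
  g ∈ subdiff F u ∧ ∀ z ∈ subdiff F u, ‖g‖ ≤ ‖z‖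

/-- `u : [0, ∞) → H` is the gradient flow of `F` starting at `u₀`: it is locally absolutely
continuous on `(0, ∞)`, continuous at `0` with value `u₀`, and `-u'(t) = grad F (u t)` for almost
every `t > 0`.  (Values at negative times are irrelevant.) -/
structure IsGradientFlow (F : H → ℝ≥0∞) (u₀ : H) (u : ℝ → H) : Prop where
  absCont : ∀ a b : ℝ, 0 < a → a ≤ b → AbsolutelyContinuousOnInterval u a b
  init : u 0 = u₀
  tendsto_init : Tendsto u (𝓝[>] 0) (𝓝 u₀)
  flow : ∀ᵐ t ∂(volume.restrict (Ioi (0 : ℝ))), ∃ g : H, IsGrad F (u t) g ∧ HasDerivAt u (-g) t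

end GradientFlow

end RotoTranslation

/-!
The estimate is an instance of the stability of gradient flows under perturbations of the
functional that are small in the uniform norm.  Testing with the pairs `(0, v)` and bounding
`∫ ε ψ` by `δ = ε |Ω|` gives

`TV_0 ≤ TV_ε ≤ TV_0 + δ`      (`TV_zero_le`, `TV_le_TV_zero_add`).

If `u`, `w` are gradient flows of `F`, `G` with `F ≤ G + δ` and `G ≤ F`, then adding the
subgradient inequality of `F` at `u`, tested with `w`, to that of `G` at `w`, tested with `u`,
yields `(u - w, u' - w') ≤ δ` almost everywhere.  Since `‖u - w‖²` is absolutely continuous, it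
grows at most by `2 δ t` (`IsGradientFlow.norm_sub_sq_le`).  For `u = W^ε` and `w = W^0` this is

`‖W^ε(t) - W^0(t)‖² ≤ 2 δ t`,

from which the convergence follows.  On the other hand `0` minimizes every `TV_ε`, so the constant
curve `0` is also a gradient flow, and comparison with it shows that `‖W^ε(t)‖ ≤ ‖U‖`
(`IsGradientFlow.norm_le`).  Thus `e = ‖W^ε(t) - W^0(t)‖` satisfies `e² ≤ 2 δ t` and `e ≤ 2 ‖U‖`,
so that `e⁵ ≤ 8 ‖U‖ δ² t² ≤ 8 ‖U‖ (TV_0(U) + δ) δ t²`, which is stronger than the stated bound.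

Convexity and lower semicontinuity of `TV_ε` matter for the existence of the flows, but not for the
comparison of given ones.
-/

namespace RotoTranslation

/-! ### Absolutely continuous curves -/

theorem absolutelyContinuousOnInterval_norm {E : Type*} [SeminormedAddCommGroup E] {f : ℝ → E}
    {a b : ℝ} (hf : AbsolutelyContinuousOnInterval f a b) :
    AbsolutelyContinuousOnInterval (fun t => ‖f t‖) a b := by
  refine squeeze_zero (fun E => Finset.sum_nonneg fun i _ => dist_nonneg)
    (fun E => Finset.sum_le_sum fun i _ => ?_) hf
  rw [dist_eq_norm (f _)]
  exact abs_norm_sub_norm_le _ _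

theorem sub_le_mul_of_absolutelyContinuousOnInterval {f f' : ℝ → ℝ} {a b c : ℝ} (hab : a ≤ b)
    (hf : AbsolutelyContinuousOnInterval f a b)
    (hf' : ∀ᵐ t ∂(volume.restrict (Ioc a b)), HasDerivAt f (f' t) t ∧ f' t ≤ c) :
    f b - f a ≤ c * (b - a) := by
  rw [← hf.integral_deriv_eq_sub]
  calc ∫ t in a..b, deriv f t ≤ ∫ _ in a..b, c := by
        refine intervalIntegral.integral_mono_ae_restrict hab hf.intervalIntegrable_deriv
          intervalIntegrable_const ?_
        rw [Measure.restrict_congr_set Ioc_ae_eq_Icc.symm]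
        filter_upwards [hf'] with t ht
        rw [ht.1.deriv]
        exact ht.2
    _ = c * (b - a) := by simp [mul_comm]

/-! ### Comparison of gradient flows -/

section Comparison

variable {H : Type*} [NormedAddCommGroup H] [InnerProductSpace ℝ H]

theorem subdiff_inner_le_toReal_sub {F : H → ℝ≥0∞} {u v z : H} (hz : z ∈ subdiff F u)
    (hv : F v ≠ ⊤) : inner ℝ z (v - u) ≤ (F v).toReal - (F u).toReal := by
  obtain ⟨hu, h⟩ := hz
  have h := h v
  rw [← ENNReal.ofReal_toReal hu, ← ENNReal.ofReal_toReal hv, EReal.coe_ennreal_ofReal,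
    EReal.coe_ennreal_ofReal, max_eq_left ENNReal.toReal_nonneg,
    max_eq_left ENNReal.toReal_nonneg] at h
  have h' : (F u).toReal + inner ℝ z (v - u) ≤ (F v).toReal := by exact_mod_cast h
  linarith

/-- Subgradients of two functionals that differ by at most `δ` are monotone up to an error `δ`. -/
theorem neg_le_inner_subdiff_sub {F G : H → ℝ≥0∞} {δ : ℝ} (hδ : 0 ≤ δ)
    (hFG : ∀ x, F x ≤ G x + ENNReal.ofReal δ) (hGF : ∀ x, G x ≤ F x) {u w z y : H}
    (hz : z ∈ subdiff F u) (hy : y ∈ subdiff G w) : -δ ≤ inner ℝ (u - w) (z - y) := by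
  have hGw : G w ≠ ⊤ := hy.1
  have hFu : F u ≠ ⊤ := hz.1
  have hadd : G w + ENNReal.ofReal δ ≠ ⊤ := ENNReal.add_ne_top.2 ⟨hGw, ENNReal.ofReal_ne_top⟩
  have hFw : F w ≠ ⊤ := ne_top_of_le_ne_top hadd (hFG w)
  have hGu : G u ≠ ⊤ := ne_top_of_le_ne_top hFu (hGF u)
  have h1 := subdiff_inner_le_toReal_sub hz hFw
  have h2 := subdiff_inner_le_toReal_sub hy hGu
  have h3 := ENNReal.toReal_mono hadd (hFG w)
  rw [ENNReal.toReal_add hGw ENNReal.ofReal_ne_top, ENNReal.toReal_ofReal hδ] at h3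
  have h4 := ENNReal.toReal_mono hFu (hGF u)
  have h5 : inner ℝ (u - w) (z - y) = -(inner ℝ z (w - u) + inner ℝ y (u - w)) := by
    rw [real_inner_comm, inner_sub_left, ← neg_sub u w, inner_neg_right]
    ring
  linarith

/-- Gradient flows of two functionals that differ by at most `δ` separate at most at the rate
`2 δ`, in squared distance.  The case `F = G`, `δ = 0` is the contraction property. -/
theorem IsGradientFlow.norm_sub_sq_le {F G : H → ℝ≥0∞} {δ : ℝ} (hδ : 0 ≤ δ)
    (hFG : ∀ x, F x ≤ G x + ENNReal.ofReal δ) (hGF : ∀ x, G x ≤ F x) {u₀ w₀ : H} {u w : ℝ → H}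
    (hu : IsGradientFlow F u₀ u) (hw : IsGradientFlow G w₀ w) {t : ℝ} (ht : 0 ≤ t) :
    ‖u t - w t‖ ^ 2 ≤ ‖u₀ - w₀‖ ^ 2 + 2 * δ * t := by
  rcases ht.eq_or_lt with rfl | ht
  · simp [hu.init, hw.init]
  have key : ∀ s ∈ Ioo 0 t, ‖u t - w t‖ ^ 2 ≤ ‖u s - w s‖ ^ 2 + 2 * δ * (t - s) := by
    intro s hs
    have hac : AbsolutelyContinuousOnInterval (fun r => ‖u r - w r‖ ^ 2) s t := by
      have h := absolutelyContinuousOnInterval_norm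
        ((hu.absCont s t hs.1 hs.2.le).fun_sub (hw.absCont s t hs.1 hs.2.le))
      simpa only [sq] using h.fun_mul h
    have hd : ∀ᵐ r ∂(volume.restrict (Ioi (0 : ℝ))), ∃ e : ℝ,
        HasDerivAt (fun r => ‖u r - w r‖ ^ 2) e r ∧ e ≤ 2 * δ := by
      filter_upwards [hu.flow, hw.flow] with r ⟨z, hz, hzu⟩ ⟨y, hy, hyw⟩
      refine ⟨_, (hzu.sub hyw).norm_sq, ?_⟩
      have h := neg_le_inner_subdiff_sub hδ hFG hGF hz.1 hy.1
      have h' : inner ℝ (u r - w r) (-z - -y) = -inner ℝ (u r - w r) (z - y) := by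
        rw [← inner_neg_right]
        congr 1
        abel
      simp only [Pi.sub_apply]
      rw [h']
      linarith
    have hd' : ∀ᵐ r ∂(volume.restrict (Ioc s t)),
        HasDerivAt (fun r => ‖u r - w r‖ ^ 2) (deriv (fun r => ‖u r - w r‖ ^ 2) r) r ∧
          deriv (fun r => ‖u r - w r‖ ^ 2) r ≤ 2 * δ := by
      filter_upwards [ae_restrict_of_ae_restrict_of_subset
        (fun r hr => hs.1.trans hr.1 : Ioc s t ⊆ Ioi 0) hd] with r ⟨e, he, hle⟩
      rw [he.deriv]
      exact ⟨he, hle⟩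
    have h := sub_le_mul_of_absolutelyContinuousOnInterval hs.2.le hac hd'
    linarith
  have hlim : Tendsto (fun s => ‖u s - w s‖ ^ 2 + 2 * δ * (t - s)) (𝓝[>] 0)
      (𝓝 (‖u₀ - w₀‖ ^ 2 + 2 * δ * (t - 0))) := by
    refine ((hu.tendsto_init.sub hw.tendsto_init).norm.pow 2).add ?_
    exact ((continuous_const.mul (continuous_const.sub continuous_id)).tendsto (0 : ℝ)).mono_left
      nhdsWithin_le_nhds
  rw [sub_zero] at hlim
  refine ge_of_tendsto hlim ?_
  filter_upwards [Ioo_mem_nhdsGT ht] with s hs using key s hs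

/-- If `0` minimizes `F`, the constant curve `0` is a gradient flow of `F`. -/
theorem isGradientFlow_zero {F : H → ℝ≥0∞} (h0 : F 0 ≠ ⊤) (hmin : ∀ x, F 0 ≤ F x) :
    IsGradientFlow F (0 : H) (fun _ => 0) where
  absCont a b _ _ := contDiffOn_const.absolutelyContinuousOnInterval
  init := rfl
  tendsto_init := tendsto_const_nhds
  flow := by
    refine Eventually.of_forall fun t => ⟨0, ⟨⟨h0, fun v => ?_⟩, fun z _ => by simp⟩, ?_⟩
    · simpa using hmin v
    · simpa using hasDerivAt_const t (0 : H)

theorem IsGradientFlow.norm_le {F : H → ℝ≥0∞} (h0 : F 0 ≠ ⊤) (hmin : ∀ x, F 0 ≤ F x) {u₀ : H}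
    {u : ℝ → H} (hu : IsGradientFlow F u₀ u) {t : ℝ} (ht : 0 ≤ t) : ‖u t‖ ≤ ‖u₀‖ := by
  have h := hu.norm_sub_sq_le le_rfl (fun x => le_self_add) (fun x => le_rfl)
    (isGradientFlow_zero h0 hmin) ht
  simp only [sub_zero, mul_zero, zero_mul, add_zero] at h
  exact (sq_le_sq₀ (norm_nonneg _) (norm_nonneg _)).1 h

end Comparison

/-! ### Comparison of the functionals `TV_ε` -/

section TotalVariation

variable {m : ℕ} {DS DA 𝔢 ε : ℝ} {Ωf : Set (Pos m)} {ψ : PosOri m → ℝ}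
  {v : PosOri m → Pos m × Pos m}

theorem metricSq_nonneg (hDS : 0 < DS) (hDA : 0 < DA) (n : Ori m) (w : Pos m × Pos m) :
    0 ≤ metricSq DS DA 𝔢 n w := by
  unfold metricSq
  split_ifs <;> positivity

theorem isTestFun_zero : IsTestFun Ωf (fun _ => 0) where
  smooth := contMDiff_const
  compactSupp := HasCompactSupport.zero
  subset := (tsupport_eq_empty_iff.2 rfl).subset.trans (empty_subset _)

theorem isTestField_zero : IsTestField 𝔢 Ωf (fun _ => 0) where
  smooth := contMDiff_const
  tangent _ := by simp
  horizontal _ _ := by simp [orthPart]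
  vanish _ _ := rfl
  compactSupp := HasCompactSupport.zero

theorem divergence_zero (p : PosOri m) : divergence 𝔢 (fun _ => 0) p = 0 := by
  have h : radialExt (fun _ : Ori m => (0 : Pos m)) = fun _ => 0 := by
    funext y
    simp [radialExt]
  simp [divergence, divSphere, h]

theorem IsAdmissible.zero_fun (h : IsAdmissible DS DA 𝔢 Ωf ψ v) :
    IsAdmissible DS DA 𝔢 Ωf (fun _ => 0) v where
  testFun := isTestFun_zero
  testField := h.testField
  bound p hp := by nlinarith [h.bound p hp, sq_nonneg (ψ p)]

theorem IsAdmissible.zero_field (hDS : 0 < DS) (hDA : 0 < DA)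
    (h : IsAdmissible DS DA 𝔢 Ωf ψ v) : IsAdmissible DS DA 𝔢 Ωf ψ (fun _ => 0) where
  testFun := h.testFun
  testField := isTestField_zero
  bound p hp := by
    have h0 : metricSq DS DA 𝔢 p.2 0 = 0 := by simp [metricSq, orthPart]
    linarith [h.bound p hp, metricSq_nonneg (𝔢 := 𝔢) hDS hDA p.2 (v p)]

theorem IsAdmissible.abs_le_one (hDS : 0 < DS) (hDA : 0 < DA)
    (h : IsAdmissible DS DA 𝔢 Ωf ψ v) {p : PosOri m} (hp : p ∈ dom Ωf) : |ψ p| ≤ 1 := by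
  rw [← sq_le_one_iff_abs_le_one]
  linarith [h.bound p hp, metricSq_nonneg (𝔢 := 𝔢) hDS hDA p.2 (v p)]

theorem IsAdmissible.le_TV (h : IsAdmissible DS DA 𝔢 Ωf ψ v) (u : L2 DS DA Ωf) :
    ENNReal.ofReal (∫ p, (ε * ψ p + u p * divergence 𝔢 v p) ∂(volOn DS DA Ωf)) ≤
      TV DS DA 𝔢 Ωf ε u :=
  le_iSup_of_le ψ (le_iSup_of_le v (le_iSup_of_le h le_rfl))

theorem TV_zero_le (u : L2 DS DA Ωf) : TV DS DA 𝔢 Ωf 0 u ≤ TV DS DA 𝔢 Ωf ε u := by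
  refine iSup_le fun ψ => iSup_le fun v => iSup_le fun h => ?_
  simpa using h.zero_fun.le_TV (ε := ε) u

theorem vol_dom_lt_top (hvol : volume Ωf < ⊤) : vol m DS DA (dom Ωf) < ⊤ := by
  have : IsFiniteMeasure (ENNReal.ofReal DA⁻¹ • (volume : Measure (Pos m)).toSphere) :=
    Measure.smul_finite _ ENNReal.ofReal_ne_top
  rw [vol, dom, Measure.prod_prod]
  refine ENNReal.mul_lt_top ?_ (measure_lt_top _ _)
  simpa using ENNReal.mul_lt_top ENNReal.ofReal_lt_top hvol

theorem volOn_ae_mem_dom (hΩ : IsOpen Ωf) : ∀ᵐ p ∂(volOn DS DA Ωf), p ∈ dom Ωf :=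
  ae_restrict_mem (hΩ.measurableSet.prod MeasurableSet.univ)

theorem isFiniteMeasure_volOn (hvol : volume Ωf < ⊤) : IsFiniteMeasure (volOn DS DA Ωf) :=
  isFiniteMeasure_restrict.2 (vol_dom_lt_top hvol).ne

theorem IsAdmissible.integrable (hDS : 0 < DS) (hDA : 0 < DA) (hΩ : IsOpen Ωf)
    (hvol : volume Ωf < ⊤) (h : IsAdmissible DS DA 𝔢 Ωf ψ v) :
    Integrable ψ (volOn DS DA Ωf) := by
  have := isFiniteMeasure_volOn (DS := DS) (DA := DA) hvol
  refine Integrable.of_bound h.testFun.smooth.continuous.aestronglyMeasurable 1 ?_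
  filter_upwards [volOn_ae_mem_dom hΩ] with p hp using h.abs_le_one hDS hDA hp

theorem IsAdmissible.integral_le (hDS : 0 < DS) (hDA : 0 < DA) (hΩ : IsOpen Ωf)
    (hvol : volume Ωf < ⊤) (h : IsAdmissible DS DA 𝔢 Ωf ψ v) :
    ∫ p, ψ p ∂(volOn DS DA Ωf) ≤ domVol DS DA Ωf := by
  have := isFiniteMeasure_volOn (DS := DS) (DA := DA) hvol
  calc ∫ p, ψ p ∂(volOn DS DA Ωf) ≤ ∫ _, (1 : ℝ) ∂(volOn DS DA Ωf) := by
        refine integral_mono_ae (h.integrable hDS hDA hΩ hvol) (integrable_const _) ?_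
        filter_upwards [volOn_ae_mem_dom hΩ] with p hp
          using (le_abs_self _).trans (h.abs_le_one hDS hDA hp)
    _ = domVol DS DA Ωf := by simp [volOn, domVol, Measure.real]

theorem TV_le_TV_zero_add (hDS : 0 < DS) (hDA : 0 < DA) (hΩ : IsOpen Ωf)
    (hvol : volume Ωf < ⊤) (hε : 0 ≤ ε) (u : L2 DS DA Ωf) :
    TV DS DA 𝔢 Ωf ε u ≤ TV DS DA 𝔢 Ωf 0 u + ENNReal.ofReal (ε * domVol DS DA Ωf) := by
  refine iSup_le fun ψ => iSup_le fun v => iSup_le fun h => ?_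
  have hψ : Integrable (fun p => ε * ψ p) (volOn DS DA Ωf) :=
    (h.integrable hDS hDA hΩ hvol).const_mul ε
  -- `div v` is continuous with compact support, so `U div v` is in fact integrable.  The inequality
  -- does not depend on this: a divergent integral has the value `0`, which is below the bound.
  by_cases hu : Integrable (fun p => u p * divergence 𝔢 v p) (volOn DS DA Ωf)
  · rw [integral_add hψ hu, add_comm, integral_const_mul]
    refine ENNReal.ofReal_add_le.trans (add_le_add ?_ (ENNReal.ofReal_le_ofReal ?_))
    · simpa using h.le_TV (ε := 0) u
    · exact mul_le_mul_of_nonneg_left (h.integral_le hDS hDA hΩ hvol) hε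
  · rw [integral_undef fun hadd => hu ((integrable_add_iff_integrable_right' hψ).1 hadd)]
    simp

theorem TV_apply_zero_le (hDS : 0 < DS) (hDA : 0 < DA) (u : L2 DS DA Ωf) :
    TV DS DA 𝔢 Ωf ε 0 ≤ TV DS DA 𝔢 Ωf ε u := by
  refine iSup_le fun ψ => iSup_le fun v => iSup_le fun h => ?_
  refine le_trans (le_of_eq ?_) ((h.zero_field hDS hDA).le_TV u)
  congr 1
  refine integral_congr_ae ?_
  filter_upwards [Lp.coeFn_zero ℝ 2 (volOn DS DA Ωf)] with p hp
  rw [hp]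
  simp [divergence_zero]

theorem TV_zero_apply_zero : TV DS DA 𝔢 Ωf 0 (0 : L2 DS DA Ωf) = 0 := by
  refine le_antisymm (iSup_le fun ψ => iSup_le fun v => iSup_le fun h => ?_) zero_le
  rw [integral_eq_zero_of_ae, ENNReal.ofReal_zero]
  filter_upwards [Lp.coeFn_zero ℝ 2 (volOn DS DA Ωf)] with p hp
  rw [hp]
  simp

theorem TV_apply_zero_ne_top (hDS : 0 < DS) (hDA : 0 < DA) (hΩ : IsOpen Ωf)
    (hvol : volume Ωf < ⊤) (hε : 0 ≤ ε) : TV DS DA 𝔢 Ωf ε (0 : L2 DS DA Ωf) ≠ ⊤ := by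
  refine ne_top_of_le_ne_top ?_ (TV_le_TV_zero_add hDS hDA hΩ hvol hε 0)
  simp [TV_zero_apply_zero]

end TotalVariation

/-! ### The Hölder rate -/

theorem le_eight_mul_rpow {e a T δ t : ℝ} (he : 0 ≤ e) (hδ : 0 ≤ δ) (hT : 0 ≤ T)
    (hsq : e ^ 2 ≤ 2 * δ * t) (hea : e ≤ 2 * a) :
    e ≤ 8 * (a * (T + δ) * δ * t ^ 2) ^ ((1 : ℝ) / 5) := by
  have ha : 0 ≤ a := by linarith
  set X := a * (T + δ) * δ * t ^ 2 with hX
  have hX0 : 0 ≤ X := by positivity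
  have h4 : e ^ 4 ≤ (2 * δ * t) ^ 2 := by
    calc e ^ 4 = (e ^ 2) ^ 2 := by ring
      _ ≤ _ := pow_le_pow_left₀ (sq_nonneg e) hsq 2
  have h5 : e ^ 5 ≤ 8 ^ 5 * X := by
    calc e ^ 5 = e ^ 4 * e := by ring
      _ ≤ (2 * δ * t) ^ 2 * (2 * a) := mul_le_mul h4 hea he (sq_nonneg _)
      _ = 8 * (a * (0 + δ) * δ * t ^ 2) := by ring
      _ ≤ 8 * X := by rw [hX]; gcongr
      _ ≤ 8 ^ 5 * X := by linarith
  have hroot : (X ^ ((1 : ℝ) / 5)) ^ 5 = X := by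
    rw [← Real.rpow_natCast, ← Real.rpow_mul hX0]
    norm_num
  refine le_of_pow_le_pow_left₀ (by norm_num : 5 ≠ 0) (by positivity) ?_
  rw [mul_pow, hroot]
  exact h5

end RotoTranslation

theorem theorem1 (m : ℕ) (hm : 1 ≤ m) (DS DA 𝔢 : ℝ) (hDS : 0 < DS) (hDA : 0 < DA) (h𝔢 : 0 ≤ 𝔢)
    (Ωf : Set (RotoTranslation.Pos m)) (hΩ : IsOpen Ωf) (hvol : volume Ωf < ⊤)
    (U : RotoTranslation.L2 DS DA Ωf)
    (W : ℝ → ℝ → RotoTranslation.L2 DS DA Ωf)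
    (hW : ∀ ε : ℝ, 0 ≤ ε →
      RotoTranslation.IsGradientFlow (RotoTranslation.TV DS DA 𝔢 Ωf ε) U (W ε)) :
    (∀ t : ℝ, 0 ≤ t → Tendsto (fun ε : ℝ => W ε t) (𝓝[>] 0) (𝓝 (W 0 t))) ∧
    (RotoTranslation.IsBV DS DA 𝔢 Ωf U →
      ∀ ε : ℝ, 0 ≤ ε → ∀ δ : ℝ, δ = ε * RotoTranslation.domVol DS DA Ωf →
        ∀ t : ℝ, 0 ≤ t →
          ‖W ε t - W 0 t‖ ≤
            8 * (‖U‖ * ((RotoTranslation.TV DS DA 𝔢 Ωf 0 U).toReal + δ) * δ * t ^ 2)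
              ^ ((1 : ℝ) / 5)) := by
  have hvol0 : 0 ≤ RotoTranslation.domVol DS DA Ωf := ENNReal.toReal_nonneg
  have hsq : ∀ ε : ℝ, 0 ≤ ε → ∀ t : ℝ, 0 ≤ t →
      ‖W ε t - W 0 t‖ ^ 2 ≤ 2 * (ε * RotoTranslation.domVol DS DA Ωf) * t := by
    intro ε hε t ht
    simpa using (hW ε hε).norm_sub_sq_le (mul_nonneg hε hvol0)
      (RotoTranslation.TV_le_TV_zero_add hDS hDA hΩ hvol hε) RotoTranslation.TV_zero_le
      (hW 0 le_rfl) ht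
  refine ⟨fun t ht => ?_, ?_⟩
  · rw [tendsto_iff_norm_sub_tendsto_zero]
    have hlim : Tendsto
        (fun ε : ℝ => Real.sqrt (2 * (ε * RotoTranslation.domVol DS DA Ωf) * t)) (𝓝[>] 0) (𝓝 0) := by
      have hc : Continuous
          (fun ε : ℝ => Real.sqrt (2 * (ε * RotoTranslation.domVol DS DA Ωf) * t)) := by
        fun_prop
      simpa using (hc.tendsto 0).mono_left nhdsWithin_le_nhds
    refine tendsto_of_tendsto_of_tendsto_of_le_of_le' tendsto_const_nhds hlim
      (Eventually.of_forall fun ε => norm_nonneg _) ?_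
    filter_upwards [self_mem_nhdsWithin] with ε hε
    exact Real.le_sqrt_of_sq_le (hsq ε (mem_Ioi.1 hε).le t ht)
  · rintro - ε hε δ rfl t ht
    have hnorm : ∀ ε : ℝ, 0 ≤ ε → ‖W ε t‖ ≤ ‖U‖ := fun ε hε =>
      (hW ε hε).norm_le (RotoTranslation.TV_apply_zero_ne_top hDS hDA hΩ hvol hε)
        (RotoTranslation.TV_apply_zero_le hDS hDA) ht
    refine RotoTranslation.le_eight_mul_rpow (norm_nonneg _) (mul_nonneg hε hvol0)
      ENNReal.toReal_nonneg (hsq ε hε t ht) ?_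
    linarith [norm_sub_le (W ε t) (W 0 t), hnorm ε hε, hnorm 0 le_rfl]
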